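/- Let $\mu$ be a finite positive Borel measure on $[0,1)$ with moments $\mu_n=\int_{[0,1)}t^n\,d\mu(t)$, $n=0,1,2,\dots$. For $1<p<\infty$ let $p'$ be the conjugate exponent, $\frac1p+\frac1{p'}=1$, and let $B^p$ be the analytic Besov space of all functions $f$ analytic in the unit disc $\mathbb D$ such that $$\|f\|_{B^p}=\left(|f(0)|^p+\int_{\mathbb D}(1-|z|^2)^{p-2}|f'(z)|^p\,dA(z)\right)^{1/p}<\infty ,$$ where $dA(z)=\frac{dx\,dy}{\pi}$ is the normalized area measure on $\mathbb D$. For $f(z)=\sum_{k=0}^\infty a_kz^k$ analytic in $\mathbb D$ put $$\mathcal H_\mu(f)(z)=\sum_{n=0}^\infty\left(\sum_{k=0}^\infty \mu_{n+k}a_k\right)z^n ,$$ and say that $\mathcal H_\mu$ is well defined in $B^p$ if, for every $f\in B^p$, the series $\sum_{k}\mu_{n+k}a_k$ converges for every $n\ge 0$ and the resulting power series in $z$ converges at every point of $\mathbb D$ and defines an analytic function in $\mathbb D$. (i) If $1<p\le 2$ and $\sum_{k=1}^\infty \frac{\mu_k^{p'}}{k}<\infty$, then $\mathcal H_\mu$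 is well defined in $B^p$. (ii) If $2<p<\infty$ and $\sum_{k=1}^\infty \frac{\mu_k^{p'}}{k^{p'/p}}<\infty$, then $\mathcal H_\mu$ is well defined in $B^p$. -/

import Mathlib

open MeasureTheory Filter Topology
open scoped ENNReal Nat

noncomputable section

/-- The `k`-th Taylor coefficient at the origin of a function of a complex variable. -/
def taylorCoeff (f : ℂ → ℂ) (k : ℕ) : ℂ :=
  iteratedDeriv k f 0 / (k ! : ℂ)

/-- The Besov seminorm `ρ_p(f) = (∫_𝔻 (1 - |z|²)^{p-2} |f'(z)|^p dA(z))^{1/p}`,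
where `dA = dx dy / π` is the normalized area measure, with values in `[0, ∞]`. -/
def besovSeminorm (p : ℝ) (f : ℂ → ℂ) : ℝ≥0∞ :=
  ((ENNReal.ofReal Real.pi)⁻¹ * ∫⁻ z in Metric.ball (0 : ℂ) 1,
    ENNReal.ofReal ((1 - ‖z‖ ^ 2) ^ (p - 2) * ‖deriv f z‖ ^ p)) ^ (1 / p)

/-- The Besov norm `(|f(0)|^p + ρ_p(f)^p)^{1/p}`, with values in `[0, ∞]`. -/
def besovNorm (p : ℝ) (f : ℂ → ℂ) : ℝ≥0∞ :=
  (‖f 0‖ₑ ^ p + besovSeminorm p f ^ p) ^ (1 / p)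

/-- The analytic Besov space `B^p` (`1 < p < ∞`): the functions that are analytic in the open
unit disc and have finite Besov norm. Values outside the disc are irrelevant. -/
def besovSpace (p : ℝ) : Set (ℂ → ℂ) :=
  {f | AnalyticOnNhd ℂ f (Metric.ball 0 1) ∧ besovNorm p f < ∞}

/-- The moment `μ_n = ∫_{[0,1)} t^n dμ(t)`. -/
def moment01 (μ : Measure (Set.Ico (0 : ℝ) 1)) (n : ℕ) : ℝ :=
  ∫ t, (t : ℝ) ^ n ∂μ

/-- `g = 𝓗_μ(f)` on the unit disc: every series `b n = ∑_k μ_{n+k} a_k` converges, where `a_k` are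
the Taylor coefficients of `f`, the power series `∑_n b n z^n` converges to `g z` at every point
`z` of the disc, and `g` is analytic there. -/
def IsHankelImage (μ : Measure (Set.Ico (0 : ℝ) 1)) (f g : ℂ → ℂ) : Prop :=
  ∃ b : ℕ → ℂ,
    (∀ n : ℕ, Tendsto
      (fun N : ℕ => ∑ k ∈ Finset.range N, (moment01 μ (n + k) : ℂ) * taylorCoeff f k)
      atTop (𝓝 (b n))) ∧
    (∀ z ∈ Metric.ball (0 : ℂ) 1, Tendsto
      (fun N : ℕ => ∑ n ∈ Finset.range N, b n * z ^ n) atTop (𝓝 (g z))) ∧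
    AnalyticOnNhd ℂ g (Metric.ball 0 1)

/-- The operator `𝓗_μ` is well defined on the class `X` of functions analytic in the disc. -/
def HankelWellDefinedOn (μ : Measure (Set.Ico (0 : ℝ) 1)) (X : Set (ℂ → ℂ)) : Prop :=
  ∀ f ∈ X, ∃ g : ℂ → ℂ, IsHankelImage μ f g

end

/-! Cut `∑ μ_{n+k} a_k` into dyadic blocks `N ≤ k < 2N`. By Cauchy's formula a block is the pairing
of `f'` on a circle of radius `r` with the polynomial of coefficients `μ_{n+k} / (k r^{k-1})`. If `1
- r` is comparable to `1/N`, these decrease, and Abel summation bounds the polynomial by a multiple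
of `μ_{n+N} / (1 + N|θ|)`. Young's inequality with weight `1 - r²`, then integration over the radii,
gives `ofReal_norm_block_le`: the block is at most a constant times the Besov integral over an
annulus plus `μ_{n+N}^{p'}`.

For `N = 2^j` the annuli are disjoint, so the first terms sum to at most the Besov integral; by
Cauchy condensation the second sum like `∑ μ_k^{p'} / k`. The bound is uniform in `n` because
moments decrease, so the image has bounded coefficients and its power series converges in the disc.
The condition in (ii) implies the one in (i). -/

/-! ### Abel summation and Dirichlet-type kernels -/

/-- Abel's bound for a trigonometric sum with nonnegative antitone coefficients. -/
theorem norm_one_sub_mul_sum_le (e : ℕ → ℝ) (w : ℂ) (hw : ‖w‖ = 1) (m n : ℕ)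
    (hanti : ∀ k, m ≤ k → k < m + n → e (k + 1) ≤ e k) :
    ‖(1 - w) * ∑ k ∈ Finset.Ico m (m + n + 1), (e k : ℂ) * w ^ k
      + e (m + n) * w ^ (m + n + 1)‖ ≤ |e m| + e m - e (m + n) := by
  induction n with
  | zero =>
    have h : (1 - w) * ∑ k ∈ Finset.Ico m (m + 0 + 1), (e k : ℂ) * w ^ k
      + e (m + 0) * w ^ (m + 0 + 1) = e m * w ^ m := by
      simp; ring
    rw [h]; simp [hw]
  | succ n ih =>
    have h1 := ih fun k hk hk' => hanti k hk (by omega)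
    have h2 := hanti (m + n) (by omega) (by omega)
    -- With the boundary term included, a new summand adds only `(e (m+n+1) - e (m+n)) w^(m+n+1)`,
    -- so the bounds telescope.
    have h : (1 - w) * ∑ k ∈ Finset.Ico m (m + (n + 1) + 1), (e k : ℂ) * w ^ k
      + e (m + (n + 1)) * w ^ (m + (n + 1) + 1)
      = ((1 - w) * ∑ k ∈ Finset.Ico m (m + n + 1), (e k : ℂ) * w ^ k
      + e (m + n) * w ^ (m + n + 1)) + ((e (m + n + 1) - e (m + n) : ℝ) : ℂ) * w ^ (m + n + 1) := by
      rw [← add_assoc, Finset.sum_Ico_succ_top (by omega)]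
      push_cast; ring
    rw [h]
    refine (norm_add_le _ _).trans ?_
    rw [norm_mul, norm_pow, hw, one_pow, mul_one, Complex.norm_real, Real.norm_eq_abs,
      abs_of_nonpos (sub_nonpos.2 h2), ← add_assoc]
    linarith

theorem norm_one_sub_mul_norm_sum_le (e : ℕ → ℝ) (w : ℂ) (hw : ‖w‖ = 1) {m M : ℕ} (hm : m ≤ M)
    (h0 : ∀ k, m ≤ k → 0 ≤ e k)
    (hanti : ∀ k, m ≤ k → k + 1 < M → e (k + 1) ≤ e k) :
    ‖1 - w‖ * ‖∑ k ∈ Finset.Ico m M, (e k : ℂ) * w ^ k‖ ≤ 2 * e m := by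
  rcases hm.eq_or_lt with rfl | hlt
  · simpa using h0 m le_rfl
  obtain ⟨n, rfl⟩ : ∃ n, M = m + n + 1 := ⟨M - m - 1, by omega⟩
  have h := norm_one_sub_mul_sum_le e w hw m n fun k hk hk' => hanti k hk (by omega)
  rw [abs_of_nonneg (h0 m le_rfl)] at h
  have h2 : ‖(e (m + n) : ℂ) * w ^ (m + n + 1)‖ = e (m + n) := by
    rw [norm_mul, norm_pow, hw, one_pow, mul_one, Complex.norm_real, Real.norm_eq_abs,
      abs_of_nonneg (h0 _ (by omega))]
  rw [← norm_mul]
  have := norm_sub_le ((1 - w) * ∑ k ∈ Finset.Ico m (m + n + 1), (e k : ℂ) * w ^ k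
      + e (m + n) * w ^ (m + n + 1)) (e (m + n) * w ^ (m + n + 1))
  rw [add_sub_cancel_right, h2] at this
  linarith

/-- The left factor is Jordan's inequality applied to `|1 - e^{-iθ}| = 2|sin(θ/2)|`. -/
theorem two_div_pi_mul_abs_le_norm_one_sub_exp {θ : ℝ} (hθ : |θ| ≤ Real.pi) :
    2 / Real.pi * |θ| ≤ ‖1 - Complex.exp (-(θ * Complex.I))‖ := by
  have h := Complex.norm_exp_I_mul_ofReal_sub_one (-θ)
  have h2 : Complex.I * ((-θ : ℝ) : ℂ) = -(θ * Complex.I) := by push_cast; ring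
  rw [norm_sub_rev, ← h2, h, norm_mul, Real.norm_eq_abs, Real.norm_eq_abs]
  have h3 : |(-θ) / 2| ≤ Real.pi / 2 := by
    rw [abs_div, abs_neg, abs_two]; linarith
  have := Real.mul_abs_le_abs_sin h3
  rw [abs_div, abs_neg, abs_two] at this
  rw [abs_two]; linarith

theorem norm_exp_neg_mul_I (θ : ℝ) : ‖Complex.exp (-(θ * Complex.I))‖ = 1 := by
  have : -((θ : ℂ) * Complex.I) = ((-θ : ℝ) : ℂ) * Complex.I := by push_cast; ring
  rw [this, Complex.norm_exp_ofReal_mul_I]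

/-- Dirichlet-kernel type bound for a block of at most `N` antitone coefficients. -/
theorem norm_sum_exp_le (e : ℕ → ℝ) {m M N : ℕ} (hm : m ≤ M) (hMN : M ≤ m + N)
    (h0 : ∀ k, m ≤ k → 0 ≤ e k)
    (hanti : ∀ k, m ≤ k → k + 1 < M → e (k + 1) ≤ e k) {θ : ℝ} (hθ : |θ| ≤ Real.pi) :
    ‖∑ k ∈ Finset.Ico m M, (e k : ℂ) * Complex.exp (-(θ * Complex.I)) ^ k‖
      ≤ (1 + Real.pi) * N * e m / (1 + N * |θ|) := by
  have hw := norm_exp_neg_mul_I θ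
  have h1 := norm_one_sub_mul_norm_sum_le e _ hw hm h0 hanti
  have h2 := two_div_pi_mul_abs_le_norm_one_sub_exp hθ
  set K := ‖∑ k ∈ Finset.Ico m M, (e k : ℂ) * Complex.exp (-(θ * Complex.I)) ^ k‖ with hK
  have hle : ∀ k, m ≤ k → k < M → e k ≤ e m := by
    intro k hk
    induction k, hk using Nat.le_induction with
    | base => intro _; exact le_rfl
    | succ k hk ih => intro h; exact (hanti k hk h).trans (ih (by omega))
  have h3 : K ≤ N * e m := by
    calc K ≤ ∑ k ∈ Finset.Ico m M, ‖(e k : ℂ) * Complex.exp (-(θ * Complex.I)) ^ k‖ :=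
          norm_sum_le _ _
      _ ≤ ∑ k ∈ Finset.Ico m M, e m := by
          refine Finset.sum_le_sum fun k hk => ?_
          rw [Finset.mem_Ico] at hk
          rw [norm_mul, norm_pow, hw, one_pow, mul_one, Complex.norm_real, Real.norm_eq_abs,
            abs_of_nonneg (h0 k hk.1)]
          exact hle k hk.1 hk.2
      _ = ((M - m : ℕ) : ℝ) * e m := by simp
      _ ≤ N * e m := by
          have : ((M - m : ℕ) : ℝ) ≤ N := by exact_mod_cast (by omega : M - m ≤ N)
          exact mul_le_mul_of_nonneg_right this (h0 m le_rfl)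
  have hpi := Real.pi_pos
  have hK0 : 0 ≤ K := norm_nonneg _
  have h4 : |θ| * K ≤ Real.pi * e m := by
    have := (mul_le_mul_of_nonneg_right h2 hK0).trans h1
    have h5 : 2 / Real.pi * |θ| * K = 2 * ((|θ| * K) / Real.pi) := by field_simp
    rw [h5] at this
    have : |θ| * K / Real.pi ≤ e m := by linarith
    rw [div_le_iff₀ hpi] at this; linarith
  -- The trivial bound `h3` plus `N` times Abel's bound `h4` gives `K (1 + N|θ|) ≤ (1 + π) N e m`.
  rw [le_div_iff₀ (by positivity)]
  have hN : (0 : ℝ) ≤ N := by positivity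
  nlinarith [mul_le_mul_of_nonneg_left h4 hN]

/-! ### Dyadic convergence criterion -/

/-- Convergence of a series whose partial sums over dyadic blocks are summably bounded. -/
theorem exists_tendsto_of_dyadic_bound (x : ℕ → ℂ) (β : ℕ → ℝ) (hβ : Summable β)
    (h : ∀ j M, 2 ^ j ≤ M → M ≤ 2 ^ (j + 1) → ‖∑ k ∈ Finset.Ico (2 ^ j) M, x k‖ ≤ β j) :
    ∃ b : ℂ, Tendsto (fun N => ∑ k ∈ Finset.range N, x k) atTop (𝓝 b) ∧
      ‖b‖ ≤ ‖x 0‖ + ∑' j, β j := by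
  have hβ0 : ∀ j, 0 ≤ β j := fun j => (norm_nonneg _).trans
    (h j (2 ^ j) le_rfl (Nat.pow_le_pow_right (by norm_num) (by omega)))
  have key : ∀ n J M, 2 ^ J ≤ M → M ≤ 2 ^ (J + n) →
      ‖∑ k ∈ Finset.Ico (2 ^ J) M, x k‖ ≤ ∑ j ∈ Finset.range n, β (j + J) := by
    intro n
    induction n with
    | zero =>
      intro J M h1 h2
      have : M = 2 ^ J := le_antisymm h2 h1
      simp [this]
    | succ n ih =>
      intro J M h1 h2
      rw [Finset.sum_range_succ]
      by_cases hM : M ≤ 2 ^ (J + n)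
      · exact (ih J M h1 hM).trans (le_add_of_nonneg_right (hβ0 _))
      · have hp : 2 ^ J ≤ 2 ^ (J + n) := Nat.pow_le_pow_right (by norm_num) (by omega)
        rw [← Finset.sum_Ico_consecutive _ hp (not_le.1 hM).le]
        refine (norm_add_le _ _).trans (add_le_add (ih J _ hp le_rfl) ?_)
        rw [add_comm n J]
        exact h (J + n) M (not_le.1 hM).le h2
  have key2 : ∀ J M, 2 ^ J ≤ M → ‖∑ k ∈ Finset.Ico (2 ^ J) M, x k‖ ≤ ∑' j, β (j + J) := by
    intro J M hM
    -- `M` blocks always suffice, since `M < 2 ^ M`.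
    refine (key M J M hM ?_).trans
      (((summable_nat_add_iff J).2 hβ).sum_le_tsum _ fun j _ => hβ0 _)
    exact (Nat.lt_two_pow_self).le.trans (Nat.pow_le_pow_right (by norm_num) (by omega))
  have hc : CauchySeq (fun N => ∑ k ∈ Finset.range N, x k) := by
    rw [Metric.cauchySeq_iff']
    intro ε hε
    obtain ⟨J, hJ⟩ := ((tendsto_sum_nat_add β).eventually (gt_mem_nhds hε)).exists
    refine ⟨2 ^ J, fun M hM => ?_⟩
    rw [dist_eq_norm, ← Finset.sum_Ico_eq_sub _ hM]
    exact (key2 J M hM).trans_lt hJ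
  obtain ⟨b, hb⟩ := cauchySeq_tendsto_of_complete hc
  refine ⟨b, hb, le_of_tendsto hb.norm ?_⟩
  filter_upwards [eventually_ge_atTop 1] with M hM
  have h1 := key2 0 M (by simpa using hM)
  have h2 : ∑ k ∈ Finset.range M, x k = x 0 + ∑ k ∈ Finset.Ico 1 M, x k := by
    rw [Finset.range_eq_Ico, Finset.sum_eq_sum_Ico_succ_bot (by omega)]
  rw [h2]
  exact (norm_add_le _ _).trans (by simpa using h1)

/-! ### Weighted Young inequality and kernel integrals -/

/-- Young's inequality with a weight. -/
theorem mul_le_weighted_young {p q : ℝ} (hpq : p.HolderConjugate q) {F B w : ℝ} (hF : 0 ≤ F)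
    (hB : 0 ≤ B) (hw : 0 < w) : F * B / w ≤ w ^ (p - 2) * F ^ p + B ^ q / w ^ 2 := by
  have hp := hpq.lt
  have hq := hpq.symm.lt
  -- The first exponent produces `w^(p-2)` after the `p`-th power. The second makes the total `-1`,
  -- and `(p-1)q = p` turns it into `w^(-2)`.
  have h := Real.young_inequality_of_nonneg (a := F * w ^ ((p - 2) / p))
    (b := B * w ^ (-1 - (p - 2) / p)) (by positivity) (by positivity) hpq
  have h1 : F * w ^ ((p - 2) / p) * (B * w ^ (-1 - (p - 2) / p)) = F * B / w := by
    have : w ^ ((p - 2) / p) * w ^ (-1 - (p - 2) / p) = w⁻¹ := by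
      rw [← Real.rpow_add hw, ← Real.rpow_neg_one]; congr 1; ring
    calc _ = F * B * (w ^ ((p - 2) / p) * w ^ (-1 - (p - 2) / p)) := by ring
      _ = _ := by rw [this]; rfl
  have h2 : (F * w ^ ((p - 2) / p)) ^ p = w ^ (p - 2) * F ^ p := by
    rw [Real.mul_rpow hF (by positivity), ← Real.rpow_mul hw.le, div_mul_cancel₀ _ (by linarith),
      mul_comm]
  have h3 : (B * w ^ (-1 - (p - 2) / p)) ^ q = B ^ q / w ^ 2 := by
    rw [Real.mul_rpow hB (by positivity), ← Real.rpow_mul hw.le]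
    have : (-1 - (p - 2) / p) * q = -(2 : ℕ) := by
      have hc := hpq.sub_one_mul_conj
      have hp0 : p ≠ 0 := by linarith
      push_cast
      field_simp
      linarith
    rw [this, Real.rpow_neg hw.le, Real.rpow_natCast]; rfl
  rw [h1, h2, h3] at h
  refine h.trans (add_le_add (div_le_self (by positivity) hp.le) (div_le_self (by positivity) hq.le))

theorem integral_one_add_mul_abs_rpow {q N : ℝ} (hN : 0 < N) :
    ∫ θ : ℝ, (1 + N * |θ|) ^ (-q) = N⁻¹ * ∫ u : ℝ, (1 + |u|) ^ (-q) := by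
  have := Measure.integral_comp_mul_left (fun u : ℝ => (1 + |u|) ^ (-q)) N
  rw [abs_of_pos (inv_pos.2 hN), smul_eq_mul] at this
  rw [← this]
  simp only [abs_mul, abs_of_pos hN]

theorem integrable_one_add_mul_abs_rpow {q N : ℝ} (hq : 1 < q) (hN : 0 < N) :
    Integrable (fun θ : ℝ => (1 + N * |θ|) ^ (-q)) := by
  have h : Integrable (fun u : ℝ => (1 + ‖u‖) ^ (-q)) :=
    integrable_one_add_norm (by simpa using hq)
  have := h.comp_mul_left' hN.ne'
  simpa only [norm_mul, Real.norm_eq_abs, abs_of_pos hN] using this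

/-! ### Taylor coefficients as circle integrals -/

theorem taylorCoeff_deriv (f : ℂ → ℂ) (k : ℕ) :
    taylorCoeff (deriv f) k = (k + 1) * taylorCoeff f (k + 1) := by
  unfold taylorCoeff
  rw [iteratedDeriv_succ', Nat.factorial_succ]
  have : (k ! : ℂ) ≠ 0 := by exact_mod_cast Nat.factorial_ne_zero k
  have h2 : (k + 1 : ℂ) ≠ 0 := by exact_mod_cast Nat.succ_ne_zero k
  push_cast
  field_simp

theorem circle_integral_eq_taylorCoeff {g : ℂ → ℂ} (hg : AnalyticOnNhd ℂ g (Metric.ball 0 1))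
    {r : ℝ} (hr0 : 0 < r) (hr1 : r < 1) (n : ℕ) :
    ∫ θ in (-Real.pi)..Real.pi, g (r * Complex.exp (θ * Complex.I)) *
      Complex.exp (-(θ * Complex.I)) ^ n = 2 * Real.pi * (r ^ n * taylorCoeff g n) := by
  have hd : DifferentiableOn ℂ g (Metric.closedBall 0 r) :=
    hg.differentiableOn.mono (Metric.closedBall_subset_ball hr1)
  have h := (hd.diffContOnCl_ball subset_rfl).circleIntegral_one_div_sub_center_pow_smul hr0 n
  -- Cauchy's formula is parametrized over `[0, 2π]`, polar coordinates over `(-π, π)`; periodicity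
  -- reconciles them.
  have hper : Function.Periodic (fun θ : ℝ => g (r * Complex.exp (θ * Complex.I)) *
      Complex.exp (-(θ * Complex.I)) ^ n) (2 * Real.pi) := by
    intro θ
    have h1 : Complex.exp (((θ + 2 * Real.pi : ℝ) : ℂ) * Complex.I)
        = Complex.exp (θ * Complex.I) := by
      push_cast; rw [add_mul]; exact Complex.exp_periodic _
    simp only [Complex.exp_neg, h1]
  have h2 := hper.intervalIntegral_add_eq (-Real.pi) 0
  rw [show -Real.pi + 2 * Real.pi = Real.pi by ring, zero_add] at h2
  rw [h2]
  have hrc : (r : ℂ) ≠ 0 := by exact_mod_cast hr0.ne'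
  have h3 : (∮ z in C(0, r), (1 / (z - 0) ^ (n + 1)) • g z)
      = Complex.I / r ^ n * ∫ θ in (0 : ℝ)..(2 * Real.pi), g (r * Complex.exp (θ * Complex.I)) *
      Complex.exp (-(θ * Complex.I)) ^ n := by
    rw [circleIntegral, ← intervalIntegral.integral_const_mul]
    congr 1; ext θ
    have he : Complex.exp (θ * Complex.I) ≠ 0 := Complex.exp_ne_zero _
    simp only [deriv_circleMap, circleMap, zero_add, sub_zero, smul_eq_mul, Complex.exp_neg, inv_pow, mul_pow,
      pow_succ]
    field_simp
  rw [h3] at h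
  have hI : Complex.I / (r : ℂ) ^ n ≠ 0 := div_ne_zero Complex.I_ne_zero (pow_ne_zero _ hrc)
  apply mul_left_cancel₀ hI
  rw [h, taylorCoeff, smul_eq_mul]
  field_simp

/-- The factor `e^{iθ}` compensates the index shift of differentiation, so frequency `k` picks out
`a_k`. -/
theorem circle_integral_deriv_eq_taylorCoeff {f : ℂ → ℂ}
    (hf : AnalyticOnNhd ℂ f (Metric.ball 0 1))
    {r : ℝ} (hr0 : 0 < r) (hr1 : r < 1) {k : ℕ} (hk : 1 ≤ k) :
    ∫ θ in (-Real.pi)..Real.pi, deriv f (r * Complex.exp (θ * Complex.I)) *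
      Complex.exp (θ * Complex.I) * Complex.exp (-(θ * Complex.I)) ^ k
      = 2 * Real.pi * (k * r ^ (k - 1) * taylorCoeff f k) := by
  obtain ⟨n, rfl⟩ : ∃ n, k = n + 1 := ⟨k - 1, by omega⟩
  have h := circle_integral_eq_taylorCoeff hf.deriv hr0 hr1 n
  rw [taylorCoeff_deriv] at h
  have h2 : ∀ θ : ℝ, deriv f (r * Complex.exp (θ * Complex.I)) *
      Complex.exp (θ * Complex.I) * Complex.exp (-(θ * Complex.I)) ^ (n + 1)
      = deriv f (r * Complex.exp (θ * Complex.I)) * Complex.exp (-(θ * Complex.I)) ^ n := by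
    intro θ
    have he : Complex.exp (θ * Complex.I) ≠ 0 := Complex.exp_ne_zero _
    rw [Complex.exp_neg, inv_pow, inv_pow, pow_succ]; field_simp
  simp only [h2, h, Nat.add_sub_cancel]
  push_cast; ring

theorem continuous_comp_circle {g : ℂ → ℂ} (hg : AnalyticOnNhd ℂ g (Metric.ball 0 1))
    {r : ℝ} (hr0 : 0 < r) (hr1 : r < 1) :
    Continuous fun θ : ℝ => g (r * Complex.exp (θ * Complex.I)) := by
  refine hg.continuousOn.comp_continuous (by fun_prop) fun θ => ?_
  rw [mem_ball_zero_iff, norm_mul, Complex.norm_exp_ofReal_mul_I, mul_one, Complex.norm_real,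
    Real.norm_eq_abs, abs_of_pos hr0]
  exact hr1

/-- A block of `∑ c_k a_k` as a pairing of `f'` with a trigonometric polynomial on a circle. -/
theorem circle_integral_mul_sum {f : ℂ → ℂ}
    (hf : AnalyticOnNhd ℂ f (Metric.ball 0 1)) (c : ℕ → ℝ)
    {r : ℝ} (hr0 : 0 < r) (hr1 : r < 1) {m M : ℕ} (hm : 1 ≤ m) :
    2 * Real.pi * ∑ k ∈ Finset.Ico m M, (c k : ℂ) * taylorCoeff f k
      = ∫ θ in (-Real.pi)..Real.pi, deriv f (r * Complex.exp (θ * Complex.I)) *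
      Complex.exp (θ * Complex.I) * ∑ k ∈ Finset.Ico m M,
        ((c k / (k * r ^ (k - 1)) : ℝ) : ℂ) * Complex.exp (-(θ * Complex.I)) ^ k := by
  have hc := continuous_comp_circle hf.deriv hr0 hr1
  simp only [Finset.mul_sum]
  rw [intervalIntegral.integral_finsetSum]
  · refine Finset.sum_congr rfl fun k hk => ?_
    rw [Finset.mem_Ico] at hk
    have h := circle_integral_deriv_eq_taylorCoeff hf hr0 hr1 (hm.trans hk.1)
    have h2 : ∀ θ : ℝ, deriv f (r * Complex.exp (θ * Complex.I)) *
      Complex.exp (θ * Complex.I) *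
        (((c k / (k * r ^ (k - 1)) : ℝ) : ℂ) * Complex.exp (-(θ * Complex.I)) ^ k)
        = ((c k / (k * r ^ (k - 1)) : ℝ) : ℂ) * (deriv f (r * Complex.exp (θ * Complex.I)) *
      Complex.exp (θ * Complex.I) * Complex.exp (-(θ * Complex.I)) ^ k) := fun θ => by ring
    simp only [h2]
    rw [intervalIntegral.integral_const_mul, h]
    have hk0 : (k : ℂ) ≠ 0 := by exact_mod_cast (by omega : k ≠ 0)
    have hrc : (r : ℂ) ≠ 0 := by exact_mod_cast hr0.ne'
    push_cast
    field_simp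
  · intro k _
    exact Continuous.intervalIntegrable (by fun_prop) _ _

/-! ### Block estimate on a single circle -/

/-- The weighted density in the Besov seminorm. -/
noncomputable def besovDensity (p : ℝ) (f : ℂ → ℂ) (z : ℂ) : ℝ :=
  (1 - ‖z‖ ^ 2) ^ (p - 2) * ‖deriv f z‖ ^ p

theorem measurable_besovDensity (p : ℝ) (f : ℂ → ℂ) : Measurable (besovDensity p f) := by
  have := measurable_deriv f
  unfold besovDensity
  fun_prop

/-- The denominators increase when `(k+1) r ≥ k`, that is `r ≥ 1 - 1/(k+1)`; this follows from `k +
1 ≤ 2N`. -/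
theorem coeff_quotient_antitone (c : ℕ → ℝ) (hc0 : ∀ k, 0 ≤ c k) (hc : Antitone c) {N : ℕ} {r : ℝ}
    (hN : 1 ≤ N) (hr : 1 - 1 / (2 * N) ≤ r) (k : ℕ) (hk : 1 ≤ k) (hkN : k + 1 < 2 * N + 1) :
    c (k + 1) / ((k + 1 : ℕ) * r ^ (k + 1 - 1)) ≤ c k / (k * r ^ (k - 1)) := by
  have hN' : (1 : ℝ) ≤ N := by exact_mod_cast hN
  have hr0 : 0 < r := by
    have : 1 / (2 * (N : ℝ)) ≤ 1 / 2 := by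
      apply one_div_le_one_div_of_le <;> linarith
    linarith
  obtain ⟨n, rfl⟩ : ∃ n, k = n + 1 := ⟨k - 1, by omega⟩
  simp only [Nat.add_sub_cancel]
  refine div_le_div₀ (hc0 _) (hc (by omega)) (by positivity) ?_
  rw [pow_succ]
  have h1 : ((n + 1 : ℕ) : ℝ) ≤ ((n + 1 + 1 : ℕ) : ℝ) * r := by
    have h2 : ((n + 1 + 1 : ℕ) : ℝ) ≤ 2 * N := by exact_mod_cast (by omega : n + 1 + 1 ≤ 2 * N)
    have h3 : ((n + 1 + 1 : ℕ) : ℝ) * (1 / (2 * N)) ≤ 1 := by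
      rw [mul_one_div, div_le_one (by positivity)]; exact h2
    have h4 : (0 : ℝ) ≤ ((n + 1 + 1 : ℕ) : ℝ) := by positivity
    have h5 := mul_le_mul_of_nonneg_left hr h4
    push_cast at *
    linarith
  calc _ ≤ ((n + 1 + 1 : ℕ) : ℝ) * r * r ^ n := mul_le_mul_of_nonneg_right h1 (by positivity)
    _ = _ := by ring

/-- Bernoulli's inequality gives `r^(N-1) ≥ (1 - 1/(2N))^N ≥ 1/2`. -/
theorem coeff_quotient_le {c : ℝ} (hc : 0 ≤ c) {N : ℕ} {r : ℝ}
    (hN : 1 ≤ N) (hr : 1 - 1 / (2 * N) ≤ r) (hr1 : r < 1) :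
    N * (c / (N * r ^ (N - 1))) ≤ 2 * c := by
  have hN' : (1 : ℝ) ≤ N := by exact_mod_cast hN
  have hi : 1 / (2 * (N : ℝ)) ≤ 1 / 2 := by
    apply one_div_le_one_div_of_le <;> linarith
  have hi0 : 0 < 1 / (2 * (N : ℝ)) := by positivity
  have h1 : (1 : ℝ) / 2 ≤ r ^ (N - 1) := by
    calc (1 : ℝ) / 2 = 1 + N * (-(1 / (2 * N))) := by field_simp; norm_num
      _ ≤ (1 + -(1 / (2 * N))) ^ N := one_add_mul_le_pow (by linarith) N
      _ ≤ r ^ N := pow_le_pow_left₀ (by linarith) (by linarith) N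
      _ ≤ r ^ (N - 1) := pow_le_pow_of_le_one (by linarith) hr1.le (by omega)
  have h2 : 0 < r ^ (N - 1) := by linarith
  have : N * (c / (N * r ^ (N - 1))) = c / r ^ (N - 1) := by field_simp
  rw [this, div_le_iff₀ h2]
  nlinarith

/-- Pointwise-in-radius form of the block estimate, in real integrals. -/
theorem two_pi_mul_norm_block_le {f : ℂ → ℂ} (hf : AnalyticOnNhd ℂ f (Metric.ball 0 1))
    (c : ℕ → ℝ) (hc0 : ∀ k, 0 ≤ c k) (hc : Antitone c) {N M : ℕ} (hN : 1 ≤ N) (hNM : N ≤ M)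
    (hM : M ≤ 2 * N) {r : ℝ} (hr : 1 - 1 / (2 * N) ≤ r) (hr1 : r < 1) :
    2 * Real.pi * ‖∑ k ∈ Finset.Ico N M, (c k : ℂ) * taylorCoeff f k‖ ≤
      ∫ θ in (-Real.pi)..Real.pi, ‖deriv f (r * Complex.exp (θ * Complex.I))‖ *
        (2 * (1 + Real.pi) * c N * (1 + N * |θ|)⁻¹) := by
  have hpi := Real.pi_pos
  have hN' : (1 : ℝ) ≤ N := by exact_mod_cast hN
  have hr0 : 0 < r := by
    have : 1 / (2 * (N : ℝ)) ≤ 1 / 2 := by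
      apply one_div_le_one_div_of_le <;> linarith
    linarith
  have h := congrArg norm (circle_integral_mul_sum hf c hr0 hr1 (m := N) (M := M) hN)
  rw [norm_mul, norm_mul, Complex.norm_real, Real.norm_eq_abs, abs_of_pos hpi,
    Complex.norm_two] at h
  rw [h]
  have hcont := (continuous_comp_circle hf.deriv hr0 hr1).norm
  refine intervalIntegral.norm_integral_le_of_norm_le (by linarith) ?_ ?_
  · refine ae_of_all _ fun θ hθ => ?_
    have habs : |θ| ≤ Real.pi := abs_le.2 ⟨hθ.1.le, hθ.2⟩
    rw [norm_mul, norm_mul, Complex.norm_exp_ofReal_mul_I, mul_one]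
    refine mul_le_mul_of_nonneg_left ?_ (norm_nonneg _)
    have h1 := norm_sum_exp_le (fun k => c k / (k * r ^ (k - 1))) hNM (by omega : M ≤ N + N)
      (fun k _ => div_nonneg (hc0 k) (by positivity))
      (fun k hk hk' => coeff_quotient_antitone c hc0 hc hN hr k (hN.trans hk) (by omega)) habs
    refine h1.trans ?_
    rw [← div_eq_mul_inv]
    refine div_le_div_of_nonneg_right ?_ (by positivity)
    have h2 := coeff_quotient_le (hc0 N) hN hr hr1
    calc _ = (1 + Real.pi) * (N * (c N / (N * r ^ (N - 1)))) := by ring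
      _ ≤ (1 + Real.pi) * (2 * c N) := mul_le_mul_of_nonneg_left h2 (by positivity)
      _ = _ := by ring
  · refine Continuous.intervalIntegrable ?_ _ _
    refine hcont.mul (continuous_const.mul (Continuous.inv₀ (by fun_prop) fun θ => ?_))
    positivity

/-- The constant in the block estimate. -/
noncomputable def blockConst (q : ℝ) : ℝ :=
  16 * (2 * (1 + Real.pi)) ^ q * ∫ u : ℝ, (1 + |u|) ^ (-q)

theorem blockConst_nonneg (q : ℝ) : 0 ≤ blockConst q := by
  have h1 : 0 ≤ 2 * (1 + Real.pi) := by have := Real.pi_pos; positivity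
  have h2 : 0 ≤ ∫ u : ℝ, (1 + |u|) ^ (-q) := integral_nonneg fun u => by positivity
  unfold blockConst
  positivity

/-- Here `w = 1 - r²` lies between `1/(4N)` and `1/N`. Dividing the pairing by `w` and applying
Young leaves the kernel term `w^(-2) (1 + N|θ|)^(-q)`, whose integral is of order `N² · N⁻¹ = N`.
The factor `r` is the polar Jacobian. -/
theorem ofReal_norm_block_le_circle {p q : ℝ} (hpq : p.HolderConjugate q) {f : ℂ → ℂ}
    (hf : AnalyticOnNhd ℂ f (Metric.ball 0 1))
    (c : ℕ → ℝ) (hc0 : ∀ k, 0 ≤ c k) (hc : Antitone c) {N M : ℕ} (hN : 1 ≤ N) (hNM : N ≤ M)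
    (hM : M ≤ 2 * N) {r : ℝ} (hr : 1 - 1 / (2 * N) ≤ r) (hr1 : r < 1 - 1 / (4 * N)) :
    ENNReal.ofReal (Real.pi * N * ‖∑ k ∈ Finset.Ico N M, (c k : ℂ) * taylorCoeff f k‖) ≤
      (∫⁻ θ in Set.Ioo (-Real.pi) Real.pi, ENNReal.ofReal r *
        ENNReal.ofReal (besovDensity p f (r * Complex.exp (θ * Complex.I))))
      + ENNReal.ofReal (blockConst q * N * c N ^ q) := by
  have hpi := Real.pi_pos
  have hq := hpq.symm.lt
  have hN' : (1 : ℝ) ≤ N := by exact_mod_cast hN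
  have h4N : 0 < 1 / (4 * (N : ℝ)) := by positivity
  have hhalf : 1 / (2 * (N : ℝ)) ≤ 1 / 2 := by
    apply one_div_le_one_div_of_le <;> linarith
  have hrh : 1 / 2 ≤ r := by linarith
  have hr0 : 0 < r := by linarith
  have hr1' : r < 1 := by linarith
  set S := ‖∑ k ∈ Finset.Ico N M, (c k : ℂ) * taylorCoeff f k‖ with hS
  set w := 1 - r ^ 2 with hw
  have hwlo : 1 / (4 * N) ≤ w := by nlinarith
  have hw0 : 0 < w := by linarith
  have hwhi : w * N ≤ 1 := by
    have h1 : w ≤ 2 * (1 / (2 * N)) := by nlinarith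
    calc w * N ≤ 2 * (1 / (2 * N)) * N := mul_le_mul_of_nonneg_right h1 (by linarith)
      _ = 1 := by field_simp
  -- Source of the 16 in `blockConst`.
  have hwinv : 1 / w ^ 2 ≤ 16 * N ^ 2 := by
    rw [div_le_iff₀ (by positivity)]
    have h1 : 1 ≤ 4 * N * w := by
      rw [div_le_iff₀ (by positivity)] at hwlo; linarith
    nlinarith
  set A := 2 * (1 + Real.pi) * c N with hA
  have hA0 : 0 ≤ A := by have := hc0 N; positivity
  have hcont := (continuous_comp_circle hf.deriv hr0 hr1').norm
  have hbase : ∀ θ : ℝ, 0 < 1 + (N : ℝ) * |θ| := fun θ => by positivity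
  have hcB : Continuous fun θ : ℝ => A * (1 + N * |θ|)⁻¹ :=
    continuous_const.mul (Continuous.inv₀ (by fun_prop) fun θ => (hbase θ).ne')
  have hdens : ∀ θ : ℝ, besovDensity p f (r * Complex.exp (θ * Complex.I))
      = w ^ (p - 2) * ‖deriv f (r * Complex.exp (θ * Complex.I))‖ ^ p := by
    intro θ
    simp only [besovDensity, norm_mul, Complex.norm_exp_ofReal_mul_I, mul_one, Complex.norm_real,
      Real.norm_eq_abs, abs_of_pos hr0, hw]
  have hp0 : 0 ≤ p := by linarith [hpq.lt]
  have hcD : Continuous fun θ : ℝ => besovDensity p f (r * Complex.exp (θ * Complex.I)) := by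
    simp only [hdens]
    exact continuous_const.mul (hcont.rpow_const fun _ => Or.inr hp0)
  have hD0 : ∀ θ : ℝ, 0 ≤ besovDensity p f (r * Complex.exp (θ * Complex.I)) := fun θ => by
    rw [hdens]; positivity
  have hInt := integrable_one_add_mul_abs_rpow hq (by linarith : (0 : ℝ) < N)
  have h1 : 2 * Real.pi * S / w ≤
      (∫ θ in (-Real.pi)..Real.pi, besovDensity p f (r * Complex.exp (θ * Complex.I)))
      + ∫ θ in (-Real.pi)..Real.pi, A ^ q / w ^ 2 * (1 + N * |θ|) ^ (-q) := by
    have h2 := two_pi_mul_norm_block_le hf c hc0 hc hN hNM hM hr hr1'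
    rw [← hS, ← hA] at h2
    refine (div_le_div_of_nonneg_right h2 hw0.le).trans ?_
    rw [← intervalIntegral.integral_div, ← intervalIntegral.integral_add
      (hcD.intervalIntegrable _ _) ((hInt.const_mul _).intervalIntegrable)]
    refine intervalIntegral.integral_mono (by linarith)
      (Continuous.intervalIntegrable ((hcont.mul hcB).div_const _) _ _)
      ((hcD.intervalIntegrable _ _).add ((hInt.const_mul _).intervalIntegrable)) fun θ => ?_
    have h3 := mul_le_weighted_young hpq (norm_nonneg (deriv f (r * Complex.exp (θ * Complex.I))))
      (mul_nonneg hA0 (inv_nonneg.2 (hbase θ).le)) hw0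
    refine h3.trans (le_of_eq ?_)
    simp only [hdens]
    rw [Real.mul_rpow hA0 (inv_nonneg.2 (hbase θ).le), Real.inv_rpow (hbase θ).le,
      Real.rpow_neg (hbase θ).le]
    ring
  have hJ : ∫ θ in (-Real.pi)..Real.pi, A ^ q / w ^ 2 * (1 + N * |θ|) ^ (-q)
      ≤ blockConst q * N * c N ^ q := by
    rw [intervalIntegral.integral_const_mul, intervalIntegral.integral_of_le (by linarith)]
    have h2 : ∫ θ in Set.Ioc (-Real.pi) Real.pi, (1 + N * |θ|) ^ (-q)
        ≤ (N : ℝ)⁻¹ * ∫ u : ℝ, (1 + |u|) ^ (-q) := by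
      rw [← integral_one_add_mul_abs_rpow (by linarith : (0 : ℝ) < N)]
      exact setIntegral_le_integral hInt (ae_of_all _ fun θ => Real.rpow_nonneg (hbase θ).le _)
    have hJ0 : 0 ≤ ∫ u : ℝ, (1 + |u|) ^ (-q) := integral_nonneg fun u => by positivity
    calc _ ≤ A ^ q / w ^ 2 * ((N : ℝ)⁻¹ * ∫ u : ℝ, (1 + |u|) ^ (-q)) :=
          mul_le_mul_of_nonneg_left h2 (by positivity)
      _ = A ^ q * ((N : ℝ)⁻¹ * ∫ u : ℝ, (1 + |u|) ^ (-q)) * (1 / w ^ 2) := by ring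
      _ ≤ A ^ q * ((N : ℝ)⁻¹ * ∫ u : ℝ, (1 + |u|) ^ (-q)) * (16 * N ^ 2) :=
          mul_le_mul_of_nonneg_left hwinv (by positivity)
      _ = blockConst q * N * c N ^ q := by
          rw [hA, Real.mul_rpow (by positivity) (hc0 N), blockConst]
          field_simp
  have hS0 : 0 ≤ S := norm_nonneg _
  have hI0 : 0 ≤ ∫ θ in (-Real.pi)..Real.pi, besovDensity p f (r * Complex.exp (θ * Complex.I)) :=
    intervalIntegral.integral_nonneg (by linarith) fun θ _ => hD0 θ
  have hB0 : 0 ≤ blockConst q * N * c N ^ q :=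
    mul_nonneg (mul_nonneg (blockConst_nonneg q) (by linarith)) (Real.rpow_nonneg (hc0 N) _)
  have h5 : Real.pi * N * S ≤
      r * (∫ θ in (-Real.pi)..Real.pi, besovDensity p f (r * Complex.exp (θ * Complex.I)))
      + blockConst q * N * c N ^ q := by
    -- The Jacobian costs a factor 2, as `r ≥ 1/2`.
    have h6 : Real.pi * N * S ≤ r * (2 * Real.pi * S / w) := by
      have : (N : ℝ) ≤ 1 / w := by rw [le_div_iff₀ hw0]; linarith
      calc Real.pi * N * S ≤ Real.pi * (1 / w) * S := by gcongr
        _ = 1 / 2 * (2 * Real.pi * S / w) := by ring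
        _ ≤ r * (2 * Real.pi * S / w) := by gcongr
    nlinarith
  have h7 := ENNReal.ofReal_le_ofReal h5
  rw [ENNReal.ofReal_add (by positivity) hB0, ENNReal.ofReal_mul hr0.le,
    intervalIntegral.integral_of_le (by linarith), ← restrict_Ioo_eq_restrict_Ioc,
    ofReal_integral_eq_lintegral_ofReal
      (hcD.integrableOn_Icc.mono_set Set.Ioo_subset_Icc_self) (ae_of_all _ hD0)] at h7
  rwa [lintegral_const_mul' _ _ ENNReal.ofReal_ne_top]

/-! ### Integration over dyadic annuli -/

/-- The annulus of points at distance comparable to `1 / N` from the unit circle. -/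
def dyadicAnnulus (N : ℕ) : Set ℂ :=
  {z | 1 - 1 / (2 * (N : ℝ)) ≤ ‖z‖ ∧ ‖z‖ < 1 - 1 / (4 * (N : ℝ))}

theorem measurableSet_dyadicAnnulus (N : ℕ) : MeasurableSet (dyadicAnnulus N) :=
  (measurableSet_le measurable_const measurable_norm).inter
    (measurableSet_lt measurable_norm measurable_const)

theorem lintegral_polar_annulus_le {N : ℕ} (hN : 1 ≤ N) {h : ℂ → ℝ≥0∞} (hh : Measurable h) :
    ∫⁻ r in Set.Ico (1 - 1 / (2 * (N : ℝ))) (1 - 1 / (4 * (N : ℝ))),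
      ∫⁻ θ in Set.Ioo (-Real.pi) Real.pi, ENNReal.ofReal r * h (r * Complex.exp (θ * Complex.I))
      ≤ ∫⁻ z in dyadicAnnulus N, h z := by
  have hN' : (1 : ℝ) ≤ N := by exact_mod_cast hN
  have hhalf : 1 / (2 * (N : ℝ)) ≤ 1 / 2 := by
    apply one_div_le_one_div_of_le <;> linarith
  set A := Set.Ico (1 - 1 / (2 * (N : ℝ))) (1 - 1 / (4 * (N : ℝ))) with hA
  have hA0 : ∀ r ∈ A, 0 < r := fun r hr => by have := hr.1; linarith
  have hm : Measurable fun x : ℝ × ℝ =>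
      ENNReal.ofReal x.1 * h (x.1 * Complex.exp (x.2 * Complex.I)) := by
    have : Measurable fun x : ℝ × ℝ => (x.1 * Complex.exp (x.2 * Complex.I) : ℂ) := by fun_prop
    exact (ENNReal.measurable_ofReal.comp measurable_fst).mul (hh.comp this)
  rw [← lintegral_indicator (measurableSet_dyadicAnnulus N),
    ← Complex.lintegral_comp_polarCoord_symm]
  have h1 : ∫⁻ r in A, ∫⁻ θ in Set.Ioo (-Real.pi) Real.pi,
      ENNReal.ofReal r * h (r * Complex.exp (θ * Complex.I))
      = ∫⁻ x in A ×ˢ Set.Ioo (-Real.pi) Real.pi,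
        ENNReal.ofReal x.1 * h (x.1 * Complex.exp (x.2 * Complex.I)) := by
    rw [Measure.volume_eq_prod, ← Measure.prod_restrict,
      lintegral_prod _ hm.aemeasurable]
  rw [h1]
  have h2 : ∫⁻ x in A ×ˢ Set.Ioo (-Real.pi) Real.pi,
        ENNReal.ofReal x.1 * h (x.1 * Complex.exp (x.2 * Complex.I))
      = ∫⁻ x in A ×ˢ Set.Ioo (-Real.pi) Real.pi, ENNReal.ofReal x.1 •
        (dyadicAnnulus N).indicator h (Complex.polarCoord.symm x) := by
    refine setLIntegral_congr_fun (measurableSet_Ico.prod measurableSet_Ioo) fun x hx => ?_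
    have h3 : Complex.polarCoord.symm x = x.1 * Complex.exp (x.2 * Complex.I) := by
      rw [Complex.polarCoord_symm_apply, Complex.exp_mul_I]; push_cast; rfl
    have h4 : Complex.polarCoord.symm x ∈ dyadicAnnulus N := by
      have h5 : ‖Complex.polarCoord.symm x‖ = x.1 := by
        rw [Complex.norm_polarCoord_symm, abs_of_pos (hA0 _ hx.1)]
      exact ⟨h5.symm ▸ hx.1.1, h5.symm ▸ hx.1.2⟩
    rw [h3] at h4
    simp only [h3, smul_eq_mul]
    rw [Set.indicator_of_mem h4]
  rw [h2]
  exact lintegral_mono_set (Set.prod_mono (fun r hr => hA0 r hr) subset_rfl)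

/-- Dyadic block estimate for functions analytic in the disc. -/
theorem ofReal_norm_block_le {p q : ℝ} (hpq : p.HolderConjugate q) {f : ℂ → ℂ}
    (hf : AnalyticOnNhd ℂ f (Metric.ball 0 1))
    (c : ℕ → ℝ) (hc0 : ∀ k, 0 ≤ c k) (hc : Antitone c) {N M : ℕ} (hN : 1 ≤ N) (hNM : N ≤ M)
    (hM : M ≤ 2 * N) :
    ENNReal.ofReal (Real.pi / 4 * ‖∑ k ∈ Finset.Ico N M, (c k : ℂ) * taylorCoeff f k‖) ≤
      (∫⁻ z in dyadicAnnulus N, ENNReal.ofReal (besovDensity p f z))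
      + ENNReal.ofReal (blockConst q / 4 * c N ^ q) := by
  have hpi := Real.pi_pos
  have hN' : (1 : ℝ) ≤ N := by exact_mod_cast hN
  set S := ‖∑ k ∈ Finset.Ico N M, (c k : ℂ) * taylorCoeff f k‖ with hS
  have hS0 : 0 ≤ S := norm_nonneg _
  set A := Set.Ico (1 - 1 / (2 * (N : ℝ))) (1 - 1 / (4 * (N : ℝ))) with hA
  have hvol : volume A = ENNReal.ofReal (1 / (4 * N)) := by
    rw [hA, Real.volume_Ico]; congr 1; field_simp; ring
  -- Integrating over radii, an interval of length `1/(4N)`, cancels the factor `N` in the circle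
  -- estimate.
  have h1 := lintegral_mono_ae (μ := volume.restrict A) ((ae_restrict_iff' measurableSet_Ico).2
    (ae_of_all _ fun r (hr : r ∈ A) =>
      ofReal_norm_block_le_circle hpq hf c hc0 hc hN hNM hM hr.1 hr.2))
  rw [lintegral_add_right _ measurable_const, lintegral_const, lintegral_const,
    Measure.restrict_apply_univ, hvol, ← ENNReal.ofReal_mul' (by positivity),
    ← ENNReal.ofReal_mul' (by positivity)] at h1
  have e1 : Real.pi * N * S * (1 / (4 * N)) = Real.pi / 4 * S := by field_simp
  have e2 : blockConst q * N * c N ^ q * (1 / (4 * N)) = blockConst q / 4 * c N ^ q := by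
    field_simp
  rw [← hS, e1, e2] at h1
  refine h1.trans (add_le_add_left (lintegral_polar_annulus_le hN ?_) _)
  exact ENNReal.measurable_ofReal.comp (measurable_besovDensity p f)

/-- Consecutive annuli abut: `1/(4 · 2^i) = 1/(2 · 2^(i+1))`. -/
theorem dyadicAnnulus_disjoint :
    Pairwise (Function.onFun Disjoint fun j : ℕ => dyadicAnnulus (2 ^ j)) := by
  have key : ∀ i j : ℕ, i < j → Disjoint (dyadicAnnulus (2 ^ i)) (dyadicAnnulus (2 ^ j)) := by
    intro i j hij
    rw [Set.disjoint_left]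
    intro z hi hj
    have h1 := hi.2.trans_le' hj.1
    have h2 : 1 / (2 * ((2 ^ j : ℕ) : ℝ)) ≤ 1 / (4 * ((2 ^ i : ℕ) : ℝ)) := by
      refine one_div_le_one_div_of_le (by positivity) ?_
      have : (2 : ℝ) ^ (i + 1) ≤ 2 ^ j := pow_le_pow_right₀ (by norm_num) hij
      push_cast
      rw [pow_succ] at this
      linarith
    linarith
  intro i j hij
  rcases lt_or_gt_of_ne hij with h | h
  · exact key i j h
  · exact (key j i h).symm

theorem lintegral_besovDensity_lt_top {p : ℝ} (hp : 1 < p) {f : ℂ → ℂ} (hf : f ∈ besovSpace p) :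
    ∫⁻ z in Metric.ball (0 : ℂ) 1, ENNReal.ofReal (besovDensity p f z) < ∞ := by
  have hp0 : 0 < p := by linarith
  have h1 := hf.2
  unfold besovNorm at h1
  rw [ENNReal.rpow_lt_top_iff_of_pos (by positivity)] at h1
  have h2 := (ENNReal.add_lt_top.1 h1).2
  rw [ENNReal.rpow_lt_top_iff_of_pos hp0] at h2
  unfold besovSeminorm at h2
  rw [ENNReal.rpow_lt_top_iff_of_pos (by positivity)] at h2
  refine ENNReal.lt_top_of_mul_ne_top_right h2.ne ?_
  exact ENNReal.inv_ne_zero.2 ENNReal.ofReal_ne_top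

theorem tsum_annulus_ne_top {p : ℝ} (hp : 1 < p) {f : ℂ → ℂ} (hf : f ∈ besovSpace p) :
    ∑' j : ℕ, ∫⁻ z in dyadicAnnulus (2 ^ j), ENNReal.ofReal (besovDensity p f z) ≠ ∞ := by
  rw [← lintegral_iUnion (fun j => measurableSet_dyadicAnnulus _) dyadicAnnulus_disjoint]
  refine ((lintegral_mono_set ?_).trans_lt (lintegral_besovDensity_lt_top hp hf)).ne
  refine Set.iUnion_subset fun j z hz => ?_
  rw [mem_ball_zero_iff]
  have : (0 : ℝ) < 1 / (4 * ((2 ^ j : ℕ) : ℝ)) := by positivity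
  linarith [hz.2]

/-! ### Moments and convergence of the Hankel coefficients -/

theorem moment01_nonneg (μ : Measure (Set.Ico (0 : ℝ) 1)) (n : ℕ) : 0 ≤ moment01 μ n :=
  integral_nonneg fun t => pow_nonneg t.2.1 n

theorem moment01_antitone (μ : Measure (Set.Ico (0 : ℝ) 1)) [IsFiniteMeasure μ] :
    Antitone (moment01 μ) := by
  have hint : ∀ n : ℕ, Integrable (fun t : Set.Ico (0 : ℝ) 1 => (t : ℝ) ^ n) μ := fun n =>
    Integrable.of_bound (by fun_prop) 1 (ae_of_all _ fun t => by
      rw [Real.norm_eq_abs, abs_of_nonneg (pow_nonneg t.2.1 n)]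
      exact pow_le_one₀ t.2.1 t.2.2.le)
  intro m n hmn
  exact integral_mono (hint n) (hint m) fun t => pow_le_pow_of_le_one t.2.1 t.2.2.le hmn

/-- Cauchy condensation: the weight `2^j` cancels the denominator. -/
theorem summable_moment_dyadic (μ : Measure (Set.Ico (0 : ℝ) 1)) [IsFiniteMeasure μ] {q : ℝ}
    (hq : 0 ≤ q) (hs : Summable fun k : ℕ => moment01 μ (k + 1) ^ q / ((k + 1 : ℕ) : ℝ)) :
    Summable fun j : ℕ => moment01 μ (2 ^ j) ^ q := by
  have h1 : Summable fun k : ℕ => moment01 μ k ^ q / (k : ℝ) :=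
    (summable_nat_add_iff 1).1 hs
  rw [← summable_condensed_iff_of_nonneg] at h1
  · refine h1.congr fun j => ?_
    push_cast
    field_simp
  · exact fun n => div_nonneg (Real.rpow_nonneg (moment01_nonneg μ n) _) (Nat.cast_nonneg n)
  · intro m n hm hmn
    have hm' : (0 : ℝ) < m := by exact_mod_cast hm
    exact div_le_div₀ (Real.rpow_nonneg (moment01_nonneg μ m) _)
      (Real.rpow_le_rpow (moment01_nonneg μ n) (moment01_antitone μ hmn) hq) hm'
      (by exact_mod_cast hmn)

/-- The coefficients of the Hankel image converge and are bounded uniformly. -/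
theorem exists_hankel_coeff (μ : Measure (Set.Ico (0 : ℝ) 1)) [IsFiniteMeasure μ] {p q : ℝ}
    (hpq : p.HolderConjugate q)
    (hs : Summable fun k : ℕ => moment01 μ (k + 1) ^ q / ((k + 1 : ℕ) : ℝ))
    {f : ℂ → ℂ} (hf : f ∈ besovSpace p) :
    ∃ C : ℝ, ∀ n : ℕ, ∃ b : ℂ, Tendsto
      (fun N : ℕ => ∑ k ∈ Finset.range N, (moment01 μ (n + k) : ℂ) * taylorCoeff f k)
      atTop (𝓝 b) ∧ ‖b‖ ≤ C := by
  have hq0 : 0 ≤ q := by linarith [hpq.symm.lt]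
  have hpi := Real.pi_pos
  have ht := tsum_annulus_ne_top hpq.lt hf
  set I : ℕ → ℝ≥0∞ := fun j =>
    ∫⁻ z in dyadicAnnulus (2 ^ j), ENNReal.ofReal (besovDensity p f z) with hI
  have hsum := ((ENNReal.summable_toReal ht).add
    ((summable_moment_dyadic μ hq0 hs).mul_left (blockConst q / 4))).mul_left (4 / Real.pi)
  -- This majorant uses `μ_{2^j} ≥ μ_{n+2^j}`, so it is independent of `n`; `4/π` undoes the `π/4`
  -- of the block estimate.
  set β : ℕ → ℝ := fun j =>
    4 / Real.pi * ((I j).toReal + blockConst q / 4 * moment01 μ (2 ^ j) ^ q) with hβ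
  refine ⟨moment01 μ 0 * ‖taylorCoeff f 0‖ + ∑' j, β j, fun n => ?_⟩
  have hanti : Antitone fun k => moment01 μ (n + k) :=
    fun a b hab => moment01_antitone μ (by omega)
  obtain ⟨b, hb, hbn⟩ := exists_tendsto_of_dyadic_bound
    (fun k => (moment01 μ (n + k) : ℂ) * taylorCoeff f k) β hsum (fun j M h1 h2 => by
      have h3 := ofReal_norm_block_le hpq hf.1 (fun k => moment01 μ (n + k))
        (fun k => moment01_nonneg μ _) hanti (N := 2 ^ j) Nat.one_le_two_pow h1
        (by rw [pow_succ] at h2; omega)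
      have hIj : I j ≠ ∞ := ENNReal.ne_top_of_tsum_ne_top ht j
      have h4 : 0 ≤ blockConst q / 4 * moment01 μ (n + 2 ^ j) ^ q :=
        mul_nonneg (div_nonneg (blockConst_nonneg q) (by norm_num))
          (Real.rpow_nonneg (moment01_nonneg μ _) _)
      have h5 : (∫⁻ z in dyadicAnnulus (2 ^ j), ENNReal.ofReal (besovDensity p f z))
          = ENNReal.ofReal (I j).toReal := (ENNReal.ofReal_toReal hIj).symm
      rw [h5, ← ENNReal.ofReal_add ENNReal.toReal_nonneg h4, ENNReal.ofReal_le_ofReal_iff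
        (add_nonneg ENNReal.toReal_nonneg h4)] at h3
      have h6 : blockConst q / 4 * moment01 μ (n + 2 ^ j) ^ q
          ≤ blockConst q / 4 * moment01 μ (2 ^ j) ^ q :=
        mul_le_mul_of_nonneg_left (Real.rpow_le_rpow (moment01_nonneg μ _)
          (moment01_antitone μ (by omega)) hq0) (div_nonneg (blockConst_nonneg q) (by norm_num))
      rw [hβ]
      simp only
      rw [div_mul_eq_mul_div, le_div_iff₀ hpi]
      linarith)
  refine ⟨b, hb, hbn.trans (add_le_add_left ?_ _)⟩
  rw [norm_mul, Complex.norm_real, Real.norm_eq_abs, abs_of_nonneg (moment01_nonneg μ _)]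
  exact mul_le_mul_of_nonneg_right (moment01_antitone μ (by omega)) (norm_nonneg _)

theorem exists_analytic_of_bounded_coeff (b : ℕ → ℂ) (C : ℝ) (hb : ∀ n, ‖b n‖ ≤ C) :
    ∃ g : ℂ → ℂ, (∀ z ∈ Metric.ball (0 : ℂ) 1, Tendsto
      (fun N : ℕ => ∑ n ∈ Finset.range N, b n * z ^ n) atTop (𝓝 (g z))) ∧
    AnalyticOnNhd ℂ g (Metric.ball 0 1) := by
  set P := FormalMultilinearSeries.ofScalars ℂ b with hP
  have hrad : 1 ≤ P.radius := by
    have := P.le_radius_of_bound C (r := 1) fun n => by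
      simpa [hP, FormalMultilinearSeries.ofScalars_norm] using hb n
    simpa using this
  have hfps := P.hasFPowerSeriesOnBall (lt_of_lt_of_le one_pos hrad)
  have hsub : Metric.ball (0 : ℂ) 1 ⊆ Metric.eball 0 P.radius := by
    rw [← Metric.eball_ofReal, ENNReal.ofReal_one]
    exact Metric.eball_subset_eball hrad
  refine ⟨P.sum, fun z hz => ?_, hfps.analyticOnNhd.mono hsub⟩
  have h := (hfps.hasSum (hsub hz)).tendsto_sum_nat
  simpa [hP, FormalMultilinearSeries.ofScalars, mul_comm] using h

theorem hankelWellDefinedOn_besovSpace (μ : Measure (Set.Ico (0 : ℝ) 1)) [IsFiniteMeasure μ]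
    {p q : ℝ} (hpq : p.HolderConjugate q)
    (hs : Summable fun k : ℕ => moment01 μ (k + 1) ^ q / ((k + 1 : ℕ) : ℝ)) :
    HankelWellDefinedOn μ (besovSpace p) := by
  intro f hf
  obtain ⟨C, hC⟩ := exists_hankel_coeff μ hpq hs hf
  choose b hb hbC using hC
  obtain ⟨g, hg, hga⟩ := exists_analytic_of_bounded_coeff b C hbC
  exact ⟨g, b, hb, hg, hga⟩

theorem mainTheorem12 (μ : Measure (Set.Ico (0 : ℝ) 1)) [IsFiniteMeasure μ]
    (p p' : ℝ) (hp : 1 < p) (hpp' : 1 / p + 1 / p' = 1) :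
    (p ≤ 2 →
      Summable (fun k : ℕ => moment01 μ (k + 1) ^ p' / ((k + 1 : ℕ) : ℝ)) →
      HankelWellDefinedOn μ (besovSpace p)) ∧
    (2 < p →
      Summable (fun k : ℕ => moment01 μ (k + 1) ^ p' / ((k + 1 : ℕ) : ℝ) ^ (p' / p)) →
      HankelWellDefinedOn μ (besovSpace p)) := by
  have hpq : p.HolderConjugate p' :=
    Real.holderConjugate_iff.2 ⟨hp, by simpa only [one_div] using hpp'⟩
  refine ⟨fun _ hs => hankelWellDefinedOn_besovSpace μ hpq hs, fun h2 hs => ?_⟩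
  refine hankelWellDefinedOn_besovSpace μ hpq (hs.of_nonneg_of_le (fun k => ?_) fun k => ?_)
  · exact div_nonneg (Real.rpow_nonneg (moment01_nonneg μ _) _) (Nat.cast_nonneg _)
  -- Since `(p-1)p' = p` and `p > 2`, one has `p' ≤ p`; hence `k^(p'/p) ≤ k` and comparison applies.
  · have hle : p' / p ≤ 1 := by
      rw [div_le_one (by linarith)]
      have := hpq.sub_one_mul_conj
      nlinarith [hpq.symm.lt]
    have hk : (1 : ℝ) ≤ ((k + 1 : ℕ) : ℝ) := by exact_mod_cast Nat.succ_pos k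
    refine div_le_div_of_nonneg_left (Real.rpow_nonneg (moment01_nonneg μ _) _)
      (by positivity) ?_
    calc ((k + 1 : ℕ) : ℝ) ^ (p' / p) ≤ ((k + 1 : ℕ) : ℝ) ^ (1 : ℝ) :=
          Real.rpow_le_rpow_of_exponent_le hk hle
      _ = _ := Real.rpow_one _
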